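/- Let $\Gamma$ be the classical gamma function and $\psi(x)=\Gamma'(x)/\Gamma(x)$ the digamma function for $x>0$. For a real number $a\ge0$ put $$f_a(x)=\frac12\ln(2\pi)-x+\Bigl(x-\frac12\Bigr)\ln x-\ln\Gamma(x)+\frac1{12}\psi'(x+a),\qquad x\in(0,\infty).$$ A function $f$ is called completely monotonic on an interval $I$ if it has derivatives of all orders on $I$ and $(-1)^nf^{(n)}(x)\ge0$ for all $x\in I$ and all integers $n\ge0$. Then, for real $\alpha\ge0$, the function $f_\alpha$ is completely monotonic on $(0,\infty)$ if and only if $\alpha=0$; and, for real $\beta\ge0$, the function $-f_\beta$ is completely monotonic on $(0,\infty)$ if and only if $\beta\ge\frac12$. -/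

import Mathlib

open scoped ContDiff

noncomputable section

/-- A real function `f` is completely monotonic on a (nondegenerate) interval `I` if it has
derivatives of all orders on `I` and `(-1) ^ n * f⁽ⁿ⁾(x) ≥ 0` for all `x ∈ I` and all `n ≥ 0`. -/
def CompletelyMonotonicOn (f : ℝ → ℝ) (I : Set ℝ) : Prop :=
  ContDiffOn ℝ ∞ f I ∧ ∀ n : ℕ, ∀ x ∈ I, 0 ≤ (-1 : ℝ) ^ n * iteratedDerivWithin n f I x

/-- The digamma function `ψ(x) = Γ'(x) / Γ(x)` of a real variable. -/
def realDigamma (x : ℝ) : ℝ := deriv Real.Gamma x / Real.Gamma x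

/-- The trigamma function `ψ'` of a real variable. -/
def realTrigamma (x : ℝ) : ℝ := deriv realDigamma x

/-- `f_a(x) = ½ ln (2π) - x + (x - ½) ln x - ln Γ(x) + ψ'(x + a) / 12`. -/
def gammaTrigammaFun (a x : ℝ) : ℝ :=
  (1 / 2) * Real.log (2 * Real.pi) - x + (x - 1 / 2) * Real.log x
    - Real.log (Real.Gamma x) + (1 / 12) * realTrigamma (x + a)

end

/-! Everything is decided by `g = f_a''`. The series `ψ'(x) = ∑ (x + n)⁻²` makes the difference of
`g` elementary: `g(x) - g(x + 1) = ½ ((x + a)⁻⁴ - x⁻² (x + 1)⁻²)`. All derivatives of `g` vanish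
along `x + ℕ`, so complete monotonicity of this difference passes to `g` by telescoping. Since
`f_a(n) → 0` (Stirling), it then passes from `g` to `f_a`.

For `a = 0` the difference, and for `a ≥ 1/2` its negative, is a positive combination of products of
the functions `(x + c)⁻¹`, `c ≥ 0`; the threshold `1/2` comes from `(x + 1/2)² = x (x + 1) + 1/4`.

Conversely, the sign of `g` alone gives an obstruction. If `a > 0`, then `g ~ -1/(2x²)` at `0`, so
`f_a` is not convex. If `a < 1/2`, then `(x + a)² < x (x + 1)` for large `x`, so `g > 0` there and
`-f_a` is not convex. -/

open Set Filter Topology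

/-! ### Closure properties of completely monotonic functions -/

namespace CompletelyMonotonicOn

variable {f g : ℝ → ℝ} {I : Set ℝ}

lemma congr (hf : CompletelyMonotonicOn f I) (h : EqOn g f I) : CompletelyMonotonicOn g I := by
  refine ⟨hf.1.congr h, fun n x hx => ?_⟩
  rw [iteratedDerivWithin_congr h hx]
  exact hf.2 n x hx

lemma nonneg (hf : CompletelyMonotonicOn f I) {x : ℝ} (hx : x ∈ I) : 0 ≤ f x := by
  simpa using hf.2 0 x hx

lemma contDiffWithinAt (hf : CompletelyMonotonicOn f I) {x : ℝ} (hx : x ∈ I) (n : ℕ) :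
    ContDiffWithinAt ℝ n f I x :=
  (hf.1 x hx).of_le (mod_cast le_top)

lemma add (hI : UniqueDiffOn ℝ I) (hf : CompletelyMonotonicOn f I)
    (hg : CompletelyMonotonicOn g I) : CompletelyMonotonicOn (fun x => f x + g x) I := by
  refine ⟨hf.1.add hg.1, fun n x hx => ?_⟩
  rw [iteratedDerivWithin_fun_add hx hI (hf.contDiffWithinAt hx n) (hg.contDiffWithinAt hx n),
    mul_add]
  exact add_nonneg (hf.2 n x hx) (hg.2 n x hx)

lemma const_mul {c : ℝ} (hc : 0 ≤ c) (hf : CompletelyMonotonicOn f I) :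
    CompletelyMonotonicOn (fun x => c * f x) I := by
  refine ⟨contDiffOn_const.mul hf.1, fun n x hx => ?_⟩
  rw [iteratedDerivWithin_const_mul_field, mul_left_comm]
  exact mul_nonneg hc (hf.2 n x hx)

/-- In the Leibniz formula the sign `(-1) ^ n` splits as `(-1) ^ i * (-1) ^ (n - i)`, so every
summand is nonnegative. -/
lemma mul (hI : UniqueDiffOn ℝ I) (hf : CompletelyMonotonicOn f I)
    (hg : CompletelyMonotonicOn g I) : CompletelyMonotonicOn (fun x => f x * g x) I := by
  refine ⟨hf.1.mul hg.1, fun n x hx => ?_⟩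
  change 0 ≤ _ * iteratedDerivWithin n (f * g) I x
  rw [iteratedDerivWithin_mul hx hI (hf.contDiffWithinAt hx n) (hg.contDiffWithinAt hx n),
    Finset.mul_sum]
  refine Finset.sum_nonneg fun i hi => ?_
  have hin : i ≤ n := Nat.lt_succ_iff.mp (Finset.mem_range.mp hi)
  have key := mul_nonneg (Nat.cast_nonneg (α := ℝ) (n.choose i))
    (mul_nonneg (hf.2 i x hx) (hg.2 (n - i) x hx))
  have hpow : (-1 : ℝ) ^ n = (-1) ^ i * (-1) ^ (n - i) := by
    rw [← pow_add, Nat.add_sub_cancel' hin]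
  rw [hpow]
  convert key using 1
  ring

end CompletelyMonotonicOn

/-! ### Criteria via unit shifts and via the second derivative -/

lemma iteratedDerivWithin_Ioi_comp_add_const (f : ℝ → ℝ) (n : ℕ) {c x : ℝ} (hc : 0 ≤ c)
    (hx : 0 < x) :
    iteratedDerivWithin n (fun y => f (y + c)) (Ioi 0) x =
      iteratedDerivWithin n f (Ioi 0) (x + c) := by
  rw [iteratedDerivWithin_of_isOpen isOpen_Ioi hx,
    iteratedDerivWithin_of_isOpen isOpen_Ioi (show x + c ∈ Ioi (0 : ℝ) by simp; linarith),
    iteratedDeriv_comp_add_const]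

lemma nonneg_of_sub_shift_nonneg {h : ℝ → ℝ} {x : ℝ}
    (hs : ∀ N : ℕ, 0 ≤ h (x + N) - h (x + N + 1))
    (ht : Tendsto (fun N : ℕ => h (x + N)) atTop (𝓝 0)) : 0 ≤ h x := by
  have hanti : Antitone fun N : ℕ => h (x + N) := by
    refine antitone_nat_of_succ_le fun N => ?_
    have := hs N
    push_cast
    rw [← add_assoc]
    linarith
  simpa using hanti.le_of_tendsto ht 0

/-- A smooth function whose derivatives all vanish along `x + ℕ` is completely monotonic
as soon as its backward difference is. -/
lemma CompletelyMonotonicOn.of_sub_shift {h : ℝ → ℝ} (hh : ContDiffOn ℝ ∞ h (Ioi 0))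
    (ht : ∀ n : ℕ, ∀ x : ℝ, 0 < x →
      Tendsto (fun N : ℕ => iteratedDerivWithin n h (Ioi 0) (x + N)) atTop (𝓝 0))
    (hs : CompletelyMonotonicOn (fun x => h x - h (x + 1)) (Ioi 0)) :
    CompletelyMonotonicOn h (Ioi 0) := by
  refine ⟨hh, fun n x hx => ?_⟩
  have hx : 0 < x := hx
  refine nonneg_of_sub_shift_nonneg
    (h := fun y => (-1 : ℝ) ^ n * iteratedDerivWithin n h (Ioi 0) y) (fun N => ?_) ?_
  · have hxN : 0 < x + N := by positivity
    have hsh : ContDiffOn ℝ ∞ (fun y => h (y + 1)) (Ioi 0) :=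
      hh.comp (by fun_prop) fun y (hy : 0 < y) => show 0 < y + 1 by linarith
    have := hs.2 n (x + N) hxN
    rw [show (fun x => h x - h (x + 1)) = h - fun y => h (y + 1) from rfl,
      iteratedDerivWithin_sub (show x + N ∈ Ioi (0 : ℝ) from hxN) (uniqueDiffOn_Ioi 0)
        ((hh _ hxN).of_le (mod_cast le_top)) ((hsh _ hxN).of_le (mod_cast le_top)),
      iteratedDerivWithin_Ioi_comp_add_const h n zero_le_one hxN, mul_sub] at this
    exact this
  · simpa using (ht n x hx).const_mul ((-1 : ℝ) ^ n)

lemma contDiffOn_top_of_hasDerivAt {f f' : ℝ → ℝ} {s : Set ℝ} (hs : IsOpen s)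
    (hf : ∀ x ∈ s, HasDerivAt f (f' x) x) (hf' : ContDiffOn ℝ ∞ f' s) : ContDiffOn ℝ ∞ f s := by
  rw [contDiffOn_infty_iff_deriv_of_isOpen hs]
  exact ⟨fun x hx => (hf x hx).differentiableAt.differentiableWithinAt,
    hf'.congr fun x hx => (hf x hx).deriv⟩

lemma iteratedDerivWithin_succ_of_hasDerivAt {f f' : ℝ → ℝ} {s : Set ℝ} (hs : IsOpen s)
    (hf : ∀ x ∈ s, HasDerivAt f (f' x) x) (n : ℕ) {x : ℝ} (hx : x ∈ s) :
    iteratedDerivWithin (n + 1) f s x = iteratedDerivWithin n f' s x := by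
  rw [iteratedDerivWithin_succ']
  exact iteratedDerivWithin_congr
    (fun y hy => (hf y hy).hasDerivWithinAt.derivWithin (hs.uniqueDiffWithinAt hy)) hx

/-- A convex function on `(0, ∞)` with completely monotonic second derivative which tends to `0`
along the integers is completely monotonic. -/
lemma CompletelyMonotonicOn.of_deriv_deriv {f f₁ f₂ : ℝ → ℝ}
    (h₁ : ∀ x ∈ Ioi (0 : ℝ), HasDerivAt f (f₁ x) x)
    (h₂ : ∀ x ∈ Ioi (0 : ℝ), HasDerivAt f₁ (f₂ x) x)
    (hcm : CompletelyMonotonicOn f₂ (Ioi 0))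
    (ht : Tendsto (fun n : ℕ => f n) atTop (𝓝 0)) : CompletelyMonotonicOn f (Ioi 0) := by
  have hmono : MonotoneOn f₁ (Ioi 0) := by
    refine monotoneOn_of_deriv_nonneg (convex_Ioi 0)
      (fun x hx => (h₂ x hx).continuousAt.continuousWithinAt)
      (fun x hx => (h₂ x (interior_subset hx)).differentiableAt.differentiableWithinAt)
      fun x hx => ?_
    rw [(h₂ x (interior_subset hx)).deriv]
    exact hcm.nonneg (interior_subset hx)
  have hneg : ∀ x ∈ Ioi (0 : ℝ), f₁ x ≤ 0 := by
    intro x hx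
    have hx : 0 < x := hx
    -- By the mean value theorem these differences are values `f₁ c` with `c > n`, hence at least
    -- `f₁ x` once `n > x`; their limit `0` therefore bounds `f₁ x` from above.
    have hdiff : Tendsto (fun n : ℕ => f ((n + 1 : ℕ) : ℝ) - f n) atTop (𝓝 0) := by
      simpa using (ht.comp (tendsto_add_atTop_nat 1)).sub ht
    refine ge_of_tendsto hdiff ?_
    obtain ⟨m, hm⟩ := exists_nat_gt x
    filter_upwards [eventually_ge_atTop m] with n hn
    have hn : x < n := hm.trans_le (mod_cast hn)
    obtain ⟨c, hc, hc'⟩ := exists_hasDerivAt_eq_slope f f₁ (show (n : ℝ) < n + 1 by linarith)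
      (fun y hy => (h₁ y (hx.trans (hn.trans_le hy.1))).continuousAt.continuousWithinAt)
      fun y hy => h₁ y (hx.trans (hn.trans hy.1))
    rw [add_sub_cancel_left, div_one] at hc'
    push_cast
    rw [← hc']
    exact hmono hx (hx.trans (hn.trans hc.1)) (hn.trans hc.1).le
  have hanti : AntitoneOn f (Ioi 0) := by
    refine antitoneOn_of_deriv_nonpos (convex_Ioi 0)
      (fun x hx => (h₁ x hx).continuousAt.continuousWithinAt)
      (fun x hx => (h₁ x (interior_subset hx)).differentiableAt.differentiableWithinAt)
      fun x hx => ?_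
    rw [(h₁ x (interior_subset hx)).deriv]
    exact hneg x (interior_subset hx)
  refine ⟨contDiffOn_top_of_hasDerivAt isOpen_Ioi h₁
    (contDiffOn_top_of_hasDerivAt isOpen_Ioi h₂ hcm.1), fun n x hx => ?_⟩
  match n with
  | 0 =>
    simp only [pow_zero, iteratedDerivWithin_zero, one_mul]
    refine le_of_tendsto ht ?_
    obtain ⟨m, hm⟩ := exists_nat_gt x
    filter_upwards [eventually_ge_atTop m] with n hn
    have hn : x < n := hm.trans_le (mod_cast hn)
    exact hanti hx (lt_trans hx hn) hn.le
  | 1 =>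
    rw [iteratedDerivWithin_succ_of_hasDerivAt isOpen_Ioi h₁ 0 hx]
    simpa using hneg x hx
  | n + 2 =>
    rw [iteratedDerivWithin_succ_of_hasDerivAt isOpen_Ioi h₁ (n + 1) hx,
      iteratedDerivWithin_succ_of_hasDerivAt isOpen_Ioi h₂ n hx, pow_add]
    simpa using hcm.2 n x hx

/-! ### Inverse powers and Hurwitz sums, both obeying `h_k' = -k h_{k+1}` -/

lemma iteratedDerivWithin_of_hasDerivAt_family {h : ℕ → ℝ → ℝ} {s : Set ℝ} (hs : IsOpen s)
    {k₀ : ℕ} (hd : ∀ k, k₀ ≤ k → ∀ x ∈ s, HasDerivAt (h k) (-(k * h (k + 1) x)) x)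
    (n : ℕ) {k : ℕ} (hk : k₀ ≤ k) {x : ℝ} (hx : x ∈ s) :
    iteratedDerivWithin n (h k) s x = (-1) ^ n * k.ascFactorial n * h (k + n) x := by
  induction n generalizing x with
  | zero => simp
  | succ n ih =>
    rw [iteratedDerivWithin_succ, derivWithin_congr (fun y hy => ih hy) (ih hx)]
    rw [((hd (k + n) (by lia) x hx).const_mul _).hasDerivWithinAt.derivWithin
      (hs.uniqueDiffWithinAt hx), Nat.ascFactorial_succ]
    push_cast
    rw [add_assoc k n 1]
    ring

lemma contDiffOn_of_hasDerivAt_family {h : ℕ → ℝ → ℝ} {s : Set ℝ} (hs : IsOpen s)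
    {k₀ : ℕ} (hd : ∀ k, k₀ ≤ k → ∀ x ∈ s, HasDerivAt (h k) (-(k * h (k + 1) x)) x)
    {k : ℕ} (hk : k₀ ≤ k) : ContDiffOn ℝ ∞ (h k) s := by
  rw [contDiffOn_infty]
  intro n
  induction n generalizing k with
  | zero =>
    exact contDiffOn_zero.2 fun x hx => (hd k hk x hx).continuousAt.continuousWithinAt
  | succ n ih =>
    push_cast
    rw [contDiffOn_succ_iff_deriv_of_isOpen hs]
    refine ⟨fun x hx => (hd k hk x hx).differentiableAt.differentiableWithinAt, by simp, ?_⟩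
    exact ((contDiffOn_const (c := (k : ℝ))).mul (ih (hk.trans k.le_succ))).neg.congr
      fun x hx => (hd k hk x hx).deriv

/-- The Hurwitz zeta value `∑ (x + n)⁻ᵏ`. -/
noncomputable def invPowSum (k : ℕ) (x : ℝ) : ℝ := ∑' n : ℕ, ((x + n) ^ k)⁻¹

lemma summable_invPow {k : ℕ} (hk : 2 ≤ k) {x : ℝ} (hx : 0 < x) :
    Summable fun n : ℕ => ((x + n) ^ k)⁻¹ := by
  have h := (Real.summable_one_div_nat_add_rpow x k).2 (by exact_mod_cast hk)
  refine h.congr fun n => ?_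
  rw [abs_of_pos (by positivity), Real.rpow_natCast, one_div, add_comm]

lemma hasDerivAt_inv_pow (k : ℕ) {x : ℝ} (hx : x ≠ 0) :
    HasDerivAt (fun y : ℝ => (y ^ k)⁻¹) (-(k * (x ^ (k + 1))⁻¹)) x := by
  convert! (hasDerivAt_pow k x).inv (pow_ne_zero k hx) using 1
  rcases k with _ | k
  · simp
  · simp only [Nat.add_sub_cancel]
    field_simp
    ring

lemma hasDerivAt_invPowSum {k : ℕ} (hk : 2 ≤ k) {x : ℝ} (hx : 0 < x) :
    HasDerivAt (invPowSum k) (-(k * invPowSum (k + 1) x)) x := by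
  -- On `(x / 2, ∞)` the termwise derivatives are dominated by their sizes at `x / 2`, which are
  -- summable.
  have hc : 0 < x / 2 := by positivity
  rw [invPowSum, ← tsum_mul_left, ← tsum_neg]
  unfold invPowSum
  refine hasDerivAt_tsum_of_isPreconnected (t := Ioi (x / 2)) (y₀ := x)
    (g' := fun (n : ℕ) (y : ℝ) => -(k * ((y + n) ^ (k + 1))⁻¹))
    (u := fun n : ℕ => k * ((x / 2 + n) ^ (k + 1))⁻¹)
    ((summable_invPow (by lia) hc).mul_left _) isOpen_Ioi isPreconnected_Ioi
    (fun n y hy => ?_) (fun n y hy => ?_) (half_lt_self hx) (summable_invPow hk hx)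
    (half_lt_self hx)
  · have hy : 0 < y := hc.trans hy
    exact (hasDerivAt_inv_pow k (x := y + n) (by positivity)).comp_add_const y n
  · have hy : x / 2 < y := hy
    have : 0 < y := hc.trans hy
    rw [norm_neg, Real.norm_of_nonneg (by positivity)]
    gcongr

lemma invPowSum_eq_add {k : ℕ} (hk : 2 ≤ k) {x : ℝ} (hx : 0 < x) :
    invPowSum k x = (x ^ k)⁻¹ + invPowSum k (x + 1) := by
  rw [invPowSum, (summable_invPow hk hx).tsum_eq_zero_add, invPowSum]
  simp [add_assoc, add_comm (1 : ℝ)]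

lemma tendsto_invPowSum_add_nat (k : ℕ) (x : ℝ) :
    Tendsto (fun N : ℕ => invPowSum k (x + N)) atTop (𝓝 0) := by
  -- The values are tails of one series. In the divergent case every tail is `0` by the convention
  -- for `tsum`, so the limit still holds.
  refine (tendsto_sum_nat_add fun n : ℕ => ((x + n) ^ k)⁻¹).congr fun N => ?_
  simp [invPowSum, add_assoc, add_comm (N : ℝ)]

lemma invPowSum_nonneg (k : ℕ) {x : ℝ} (hx : 0 ≤ x) : 0 ≤ invPowSum k x :=
  tsum_nonneg fun n => by positivity

lemma invPowSum_anti {k : ℕ} (hk : 2 ≤ k) {x y : ℝ} (hx : 0 < x) (hxy : x ≤ y) :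
    invPowSum k y ≤ invPowSum k x :=
  (summable_invPow hk (hx.trans_le hxy)).tsum_le_tsum
    (fun n => by gcongr) (summable_invPow hk hx)

/-! ### Digamma asymptotics and the trigamma series -/

lemma hasDerivAt_log_Gamma {x : ℝ} (hx : 0 < x) :
    HasDerivAt (Real.log ∘ Real.Gamma) (realDigamma x) x := by
  have hd : DifferentiableAt ℝ Real.Gamma x := Real.differentiableAt_Gamma fun m => by
    have : (0 : ℝ) ≤ m := m.cast_nonneg
    linarith
  exact hd.hasDerivAt.log (Real.Gamma_pos_of_pos hx).ne'

lemma log_Gamma_add_one {x : ℝ} (hx : 0 < x) :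
    Real.log (Real.Gamma (x + 1)) = Real.log (Real.Gamma x) + Real.log x := by
  rw [Real.Gamma_add_one hx.ne', Real.log_mul hx.ne' (Real.Gamma_pos_of_pos hx).ne', add_comm]

lemma realDigamma_add_one {x : ℝ} (hx : 0 < x) : realDigamma (x + 1) = realDigamma x + x⁻¹ := by
  have h₁ := (hasDerivAt_log_Gamma (by positivity : 0 < x + 1)).comp_add_const x 1
  have h₂ := (hasDerivAt_log_Gamma hx).add (Real.hasDerivAt_log hx.ne')
  refine h₁.unique (h₂.congr_of_eventuallyEq ?_)
  filter_upwards [lt_mem_nhds hx] with y hy using log_Gamma_add_one hy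

lemma realDigamma_add_nat {x : ℝ} (hx : 0 < x) (N : ℕ) :
    realDigamma (x + N) = realDigamma x + ∑ n ∈ Finset.range N, (x + n)⁻¹ := by
  induction N with
  | zero => simp
  | succ N ih =>
    rw [Finset.sum_range_succ, ← add_assoc, ← ih, ← realDigamma_add_one (by positivity)]
    push_cast
    rw [add_assoc]

/-- By convexity of `log Γ`, the slope at `x` is at most that of the chord over `[x, x + 1]`, which
is `log x`. The slope at `x + 1` gives the companion lower bound. -/
lemma realDigamma_le_log {x : ℝ} (hx : 0 < x) : realDigamma x ≤ Real.log x := by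
  have := Real.convexOn_log_Gamma.le_slope_of_hasDerivAt hx
    (show 0 < x + 1 by positivity) (by linarith) (hasDerivAt_log_Gamma hx)
  simpa [slope_def_field, log_Gamma_add_one hx] using this

lemma log_le_realDigamma_add_inv {x : ℝ} (hx : 0 < x) :
    Real.log x ≤ realDigamma x + x⁻¹ := by
  have := Real.convexOn_log_Gamma.slope_le_of_hasDerivAt hx
    (show 0 < x + 1 by positivity) (by linarith) (hasDerivAt_log_Gamma (by positivity))
  rw [← realDigamma_add_one hx]
  simpa [slope_def_field, log_Gamma_add_one hx] using this

lemma tendsto_inv_add_nat (x : ℝ) : Tendsto (fun N : ℕ => (x + N)⁻¹) atTop (𝓝 0) :=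
  tendsto_inv_atTop_zero.comp (tendsto_atTop_add_const_left _ x tendsto_natCast_atTop_atTop)

lemma tendsto_realDigamma_add_nat_sub_log {x : ℝ} (hx : 0 < x) :
    Tendsto (fun N : ℕ => realDigamma (x + N) - Real.log (x + N)) atTop (𝓝 0) := by
  refine squeeze_zero_norm (fun N => ?_) (tendsto_inv_add_nat x)
  have hxN : 0 < x + N := by positivity
  have h₁ := realDigamma_le_log hxN
  have h₂ := log_le_realDigamma_add_inv hxN
  rw [Real.norm_eq_abs, abs_le]
  constructor <;> linarith [inv_pos.2 hxN]

lemma tendsto_log_add_nat_sub_log {x y : ℝ} (hx : 0 < x) (hy : 0 < y) :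
    Tendsto (fun N : ℕ => Real.log (x + N) - Real.log (y + N)) atTop (𝓝 0) := by
  have h : Tendsto (fun N : ℕ => 1 + (x - y) * (y + N)⁻¹) atTop (𝓝 1) := by
    simpa using ((tendsto_inv_add_nat y).const_mul (x - y)).const_add 1
  have := h.log one_ne_zero
  rw [Real.log_one] at this
  refine this.congr fun N => ?_
  have hx' : 0 < x + N := by positivity
  have hy' : 0 < y + N := by positivity
  rw [← Real.log_div hx'.ne' hy'.ne']
  congr 1
  field_simp
  ring

lemma hasSum_realDigamma_sub {x y : ℝ} (hx : 0 < x) (hy : 0 < y) :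
    HasSum (fun n : ℕ => (y + n)⁻¹ - (x + n)⁻¹) (realDigamma x - realDigamma y) := by
  have hsum : Summable fun n : ℕ => (y + n)⁻¹ - (x + n)⁻¹ := by
    have hm : 0 < min x y := lt_min hx hy
    refine ((summable_invPow le_rfl hm).mul_left |x - y|).of_norm_bounded fun n => ?_
    have hx' : 0 < x + n := by positivity
    have hy' : 0 < y + n := by positivity
    have hm' : 0 < min x y + n := by positivity
    rw [inv_sub_inv hy'.ne' hx'.ne', Real.norm_eq_abs, abs_div, abs_of_pos (mul_pos hy' hx'),
      div_eq_mul_inv, add_sub_add_right_eq_sub, sq]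
    gcongr
    · exact min_le_right _ _
    · exact min_le_left _ _
  refine hsum.hasSum_iff_tendsto_nat.2 ?_
  -- The `N`th partial sum is `ψ(x) - ψ(y) + ψ(y + N) - ψ(x + N)`, and the last two terms cancel in
  -- the limit because `ψ` is asymptotic to `log`.
  have h := ((tendsto_realDigamma_add_nat_sub_log hy).sub
    (tendsto_realDigamma_add_nat_sub_log hx)).sub (tendsto_log_add_nat_sub_log hx hy)
  have := h.add_const (realDigamma x - realDigamma y)
  simp only [sub_zero, zero_add] at this
  refine this.congr fun N => ?_
  rw [realDigamma_add_nat hx, realDigamma_add_nat hy, Finset.sum_sub_distrib]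
  ring

lemma hasDerivAt_realDigamma {x : ℝ} (hx : 0 < x) :
    HasDerivAt realDigamma (invPowSum 2 x) x := by
  have hc : 0 < x / 2 := by positivity
  -- The sum is `ψ(y) - ψ(x)`; anchoring it at `x` makes every term vanish at the base point, where
  -- summability is thus trivial.
  have key : HasDerivAt (fun y : ℝ => ∑' n : ℕ, ((x + n)⁻¹ - (y + n)⁻¹)) (invPowSum 2 x) x := by
    unfold invPowSum
    refine hasDerivAt_tsum_of_isPreconnected (t := Ioi (x / 2)) (y₀ := x)
      (g := fun (n : ℕ) (y : ℝ) => (x + n)⁻¹ - (y + n)⁻¹)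
      (g' := fun (n : ℕ) (y : ℝ) => ((y + n) ^ 2)⁻¹) (u := fun n : ℕ => ((x / 2 + n) ^ 2)⁻¹)
      (summable_invPow le_rfl hc) isOpen_Ioi isPreconnected_Ioi
      (fun n y hy => ?_) (fun n y hy => ?_) (half_lt_self hx) (by simp) (half_lt_self hx)
    · have hy : 0 < y := hc.trans hy
      have := ((hasDerivAt_inv (x := y + n) (by positivity)).comp_add_const y n).const_sub
        ((x + n)⁻¹)
      simpa using this
    · have hy : x / 2 < y := hy
      have : 0 < y := hc.trans hy
      rw [Real.norm_of_nonneg (by positivity)]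
      gcongr
  refine (key.const_add (realDigamma x)).congr_of_eventuallyEq ?_
  filter_upwards [lt_mem_nhds hx] with y hy
  rw [(hasSum_realDigamma_sub hy hx).tsum_eq]
  ring

lemma realTrigamma_eq_invPowSum {x : ℝ} (hx : 0 < x) : realTrigamma x = invPowSum 2 x :=
  (hasDerivAt_realDigamma hx).deriv

/-- The first derivative of `gammaTrigammaFun a` on `(0, ∞)`. -/
noncomputable def gammaTrigammaDeriv (a x : ℝ) : ℝ :=
  Real.log x - (1 / 2) * x⁻¹ - realDigamma x - (1 / 6) * invPowSum 3 (x + a)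

/-- The second derivative of `gammaTrigammaFun a` on `(0, ∞)`. -/
noncomputable def gammaTrigammaDerivTwo (a x : ℝ) : ℝ :=
  (x ^ 1)⁻¹ + (1 / 2) * (x ^ 2)⁻¹ - invPowSum 2 x + (1 / 2) * invPowSum 4 (x + a)

/-! ### Derivatives, difference equation and limit of `f_a` -/

lemma hasDerivAt_gammaTrigammaFun {a x : ℝ} (ha : 0 ≤ a) (hx : 0 < x) :
    HasDerivAt (gammaTrigammaFun a) (gammaTrigammaDeriv a x) x := by
  have hxa : 0 < x + a := by positivity
  have hT : HasDerivAt realTrigamma (-((2 : ℕ) * invPowSum 3 (x + a))) (x + a) :=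
    (hasDerivAt_invPowSum le_rfl hxa).congr_of_eventuallyEq <| by
      filter_upwards [lt_mem_nhds hxa] with y hy using realTrigamma_eq_invPowSum hy
  have h := ((((hasDerivAt_id x).const_sub ((1 / 2) * Real.log (2 * Real.pi))).add
    (((hasDerivAt_id x).sub_const (1 / 2)).mul (Real.hasDerivAt_log hx.ne'))).sub
      (hasDerivAt_log_Gamma hx)).add ((hT.comp_add_const x a).const_mul (1 / 12))
  convert! h using 1
  simp only [gammaTrigammaDeriv, id]
  field_simp
  push_cast
  ring

lemma hasDerivAt_gammaTrigammaDeriv {a x : ℝ} (ha : 0 ≤ a) (hx : 0 < x) :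
    HasDerivAt (gammaTrigammaDeriv a) (gammaTrigammaDerivTwo a x) x := by
  have h := (((Real.hasDerivAt_log hx.ne').sub ((hasDerivAt_inv hx.ne').const_mul (1 / 2))).sub
    (hasDerivAt_realDigamma hx)).sub
      (((hasDerivAt_invPowSum (k := 3) (by lia)
        (by positivity : 0 < x + a)).comp_add_const x a).const_mul (1 / 6))
  convert! h using 1
  simp only [gammaTrigammaDerivTwo]
  push_cast
  ring

lemma gammaTrigammaDerivTwo_sub_shift {a x : ℝ} (ha : 0 ≤ a) (hx : 0 < x) :
    gammaTrigammaDerivTwo a x - gammaTrigammaDerivTwo a (x + 1) =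
      (1 / 2) * (((x + a) ^ 4)⁻¹ - (x ^ 2)⁻¹ * ((x + 1) ^ 2)⁻¹) := by
  have hxa : 0 < x + a := by positivity
  rw [gammaTrigammaDerivTwo, gammaTrigammaDerivTwo, invPowSum_eq_add le_rfl hx,
    invPowSum_eq_add (by lia) hxa, add_right_comm x 1 a]
  generalize ((x + a) ^ 4)⁻¹ = A
  field_simp
  ring

/-- Stirling's formula: for `n > 0`, `f_a(n) = ½ log π - log (stirlingSeq n) + ψ'(n + a) / 12`, and
`stirlingSeq n → √π`. -/
lemma tendsto_gammaTrigammaFun_nat {a : ℝ} (ha : 0 ≤ a) :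
    Tendsto (fun n : ℕ => gammaTrigammaFun a n) atTop (𝓝 0) := by
  have h₁ := Stirling.tendsto_stirlingSeq_sqrt_pi.log (Real.sqrt_pos.2 Real.pi_pos).ne'
  have h₂ := ((tendsto_invPowSum_add_nat 2 a).const_mul (1 / 12))
  have h := (h₁.const_sub ((1 / 2) * Real.log Real.pi)).add h₂
  rw [Real.log_sqrt Real.pi_pos.le, mul_zero, add_zero,
    show 1 / 2 * Real.log Real.pi - Real.log Real.pi / 2 = 0 by ring] at h
  refine h.congr' ?_
  filter_upwards [eventually_gt_atTop 0] with n hn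
  have hn' : (0 : ℝ) < n := by exact_mod_cast hn
  have hG := log_Gamma_add_one hn'
  rw [Real.Gamma_nat_eq_factorial] at hG
  rw [gammaTrigammaFun, realTrigamma_eq_invPowSum (by positivity),
    Stirling.log_stirlingSeq_formula, Real.log_mul two_ne_zero hn'.ne',
    Real.log_mul two_ne_zero Real.pi_pos.ne', Real.log_div hn'.ne' (Real.exp_pos 1).ne',
    Real.log_exp, hG, add_comm a]
  ring

/-! ### Decay of all derivatives along `x + ℕ` -/

lemma hasDerivAt_inv_pow_family (a : ℝ) (ha : 0 ≤ a) : ∀ k : ℕ, 0 ≤ k → ∀ x ∈ Ioi (0 : ℝ),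
    HasDerivAt (fun x => ((x + a) ^ k)⁻¹) (-(k * ((x + a) ^ (k + 1))⁻¹)) x := by
  intro k _ x hx
  have hx : 0 < x := hx
  exact (hasDerivAt_inv_pow k (x := x + a) (by positivity)).comp_add_const x a

lemma hasDerivAt_invPowSum_family (a : ℝ) (ha : 0 ≤ a) : ∀ k : ℕ, 2 ≤ k → ∀ x ∈ Ioi (0 : ℝ),
    HasDerivAt (fun x => invPowSum k (x + a)) (-(k * invPowSum (k + 1) (x + a))) x := by
  intro k hk x hx
  have hx : 0 < x := hx
  exact (hasDerivAt_invPowSum hk (x := x + a) (by positivity)).comp_add_const x a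

/-- A smooth function on `(0, ∞)` all of whose derivatives vanish along `x + ℕ` for each `x`. -/
def SmoothVanishing (h : ℝ → ℝ) : Prop :=
  ContDiffOn ℝ ∞ h (Ioi 0) ∧ ∀ n : ℕ, ∀ x : ℝ, 0 < x →
    Tendsto (fun N : ℕ => iteratedDerivWithin n h (Ioi 0) (x + N)) atTop (𝓝 0)

namespace SmoothVanishing

lemma of_family {h : ℕ → ℝ → ℝ} {k₀ : ℕ}
    (hd : ∀ k, k₀ ≤ k → ∀ x ∈ Ioi (0 : ℝ), HasDerivAt (h k) (-(k * h (k + 1) x)) x)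
    {k : ℕ} (hk : k₀ ≤ k)
    (ht : ∀ m, k ≤ m → ∀ x : ℝ, 0 < x → Tendsto (fun N : ℕ => h m (x + N)) atTop (𝓝 0)) :
    SmoothVanishing (h k) := by
  refine ⟨contDiffOn_of_hasDerivAt_family isOpen_Ioi hd hk, fun n x hx => ?_⟩
  have := (ht (k + n) (by lia) x hx).const_mul ((-1) ^ n * k.ascFactorial n : ℝ)
  rw [mul_zero] at this
  refine this.congr fun N => ?_
  rw [iteratedDerivWithin_of_hasDerivAt_family isOpen_Ioi hd n hk
    (show x + N ∈ Ioi (0 : ℝ) from add_pos_of_pos_of_nonneg hx N.cast_nonneg)]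

lemma add {f g : ℝ → ℝ} (hf : SmoothVanishing f) (hg : SmoothVanishing g) :
    SmoothVanishing (fun x => f x + g x) := by
  refine ⟨hf.1.add hg.1, fun n x hx => ?_⟩
  have := (hf.2 n x hx).add (hg.2 n x hx)
  rw [add_zero] at this
  refine this.congr fun N => ?_
  have hxN : x + N ∈ Ioi (0 : ℝ) := add_pos_of_pos_of_nonneg hx N.cast_nonneg
  rw [iteratedDerivWithin_fun_add hxN (uniqueDiffOn_Ioi 0)
    ((hf.1 _ hxN).of_le (mod_cast le_top)) ((hg.1 _ hxN).of_le (mod_cast le_top))]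

lemma const_mul (c : ℝ) {f : ℝ → ℝ} (hf : SmoothVanishing f) :
    SmoothVanishing (fun x => c * f x) := by
  refine ⟨contDiffOn_const.mul hf.1, fun n x hx => ?_⟩
  simpa [iteratedDerivWithin_const_mul_field] using (hf.2 n x hx).const_mul c

lemma inv_pow {k : ℕ} (hk : k ≠ 0) : SmoothVanishing fun x => (x ^ k)⁻¹ := by
  have hd := hasDerivAt_inv_pow_family 0 le_rfl
  simp only [add_zero] at hd
  refine of_family (h := fun k x => (x ^ k)⁻¹) hd (Nat.zero_le k) fun m hm x hx => ?_
  simpa [show m ≠ 0 by lia] using (tendsto_inv_add_nat x).pow m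

lemma invPowSum {k : ℕ} (hk : 2 ≤ k) {a : ℝ} (ha : 0 ≤ a) :
    SmoothVanishing fun x => invPowSum k (x + a) := by
  refine of_family (h := fun k x => _root_.invPowSum k (x + a))
    (hasDerivAt_invPowSum_family a ha) hk fun m hm x hx => ?_
  simpa [add_right_comm] using tendsto_invPowSum_add_nat m (x + a)

lemma gammaTrigammaDerivTwo {a : ℝ} (ha : 0 ≤ a) :
    SmoothVanishing (gammaTrigammaDerivTwo a) := by
  have h := (((inv_pow one_ne_zero).add ((inv_pow two_ne_zero).const_mul (1 / 2))).add
    ((invPowSum le_rfl le_rfl).const_mul (-1))).add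
      ((invPowSum (k := 4) (by lia) ha).const_mul (1 / 2))
  convert! h using 2 with x
  simp only [_root_.gammaTrigammaDerivTwo, add_zero]
  ring

end SmoothVanishing

/-! ### Complete monotonicity of `± f_a''` -/

lemma completelyMonotonicOn_inv_add {a : ℝ} (ha : 0 ≤ a) :
    CompletelyMonotonicOn (fun x => (x + a)⁻¹) (Ioi 0) := by
  have hd := hasDerivAt_inv_pow_family a ha
  have key : CompletelyMonotonicOn (fun x => ((x + a) ^ 1)⁻¹) (Ioi 0) := by
    refine ⟨contDiffOn_of_hasDerivAt_family (h := fun k x => ((x + a) ^ k)⁻¹) isOpen_Ioi hd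
      (Nat.zero_le 1), fun n x hx => ?_⟩
    have hx' : 0 < x := hx
    rw [iteratedDerivWithin_of_hasDerivAt_family (h := fun k x => ((x + a) ^ k)⁻¹) isOpen_Ioi hd
      n (Nat.zero_le 1) hx, mul_assoc, ← mul_assoc, ← mul_pow]
    simp only [neg_mul_neg, one_mul, one_pow]
    positivity
  simpa using key

lemma completelyMonotonicOn_gammaTrigammaDerivTwo_zero :
    CompletelyMonotonicOn (gammaTrigammaDerivTwo 0) (Ioi 0) := by
  have hU := uniqueDiffOn_Ioi (0 : ℝ)
  refine .of_sub_shift (SmoothVanishing.gammaTrigammaDerivTwo le_rfl).1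
    (SmoothVanishing.gammaTrigammaDerivTwo le_rfl).2 ?_
  have h₀ := completelyMonotonicOn_inv_add le_rfl
  have h₁ := completelyMonotonicOn_inv_add zero_le_one
  have hs := h₀.mul hU h₀
  -- With `u = x⁻¹` and `v = (x + 1)⁻¹` one has `u - v = u v`, so `u⁴ - u² v² = u² (u v) (u + v)`.
  refine (((hs.mul hU (h₀.mul hU h₁)).mul hU (h₀.add hU h₁)).const_mul
    (one_half_pos (α := ℝ)).le).congr fun x hx => ?_
  have hx : 0 < x := hx
  simp only [gammaTrigammaDerivTwo_sub_shift le_rfl hx, add_zero]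
  field_simp
  ring

/-- `(x + a)⁻⁴ - (x + b)⁻⁴` is completely monotonic for `a ≤ b`. -/
lemma completelyMonotonicOn_inv_pow_four_sub {a b : ℝ} (ha : 0 ≤ a) (hab : a ≤ b) :
    CompletelyMonotonicOn (fun x => ((x + a) ^ 4)⁻¹ - ((x + b) ^ 4)⁻¹) (Ioi 0) := by
  have hU := uniqueDiffOn_Ioi (0 : ℝ)
  have hA := completelyMonotonicOn_inv_add ha
  have hB := completelyMonotonicOn_inv_add (ha.trans hab)
  refine ((((hA.mul hU hB).mul hU (hA.add hU hB)).mul hU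
    ((hA.mul hU hA).add hU (hB.mul hU hB))).const_mul (sub_nonneg.2 hab)).congr fun x hx => ?_
  have hx : 0 < x := hx
  have : 0 < x + a := by positivity
  have : 0 < x + b := by linarith
  dsimp only
  field_simp
  ring

/-- With `p = 1 / (x (x + 1))` and `q = (x + 1/2)⁻²`, the identity `1/q - 1/p = 1/4` gives `p² - q²
= ¼ p q (p + q)`. -/
lemma completelyMonotonicOn_inv_sq_mul_inv_sq_sub :
    CompletelyMonotonicOn (fun x => (x ^ 2)⁻¹ * ((x + 1) ^ 2)⁻¹ - ((x + 1 / 2) ^ 4)⁻¹)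
      (Ioi 0) := by
  have hU := uniqueDiffOn_Ioi (0 : ℝ)
  have h₀ := completelyMonotonicOn_inv_add le_rfl
  have h₁ := completelyMonotonicOn_inv_add zero_le_one
  have h := completelyMonotonicOn_inv_add (one_half_pos (α := ℝ)).le
  have hp := h₀.mul hU h₁
  have hq := h.mul hU h
  refine (((hp.mul hU hq).mul hU (hp.add hU hq)).const_mul
    (by norm_num : (0 : ℝ) ≤ 1 / 4)).congr fun x hx => ?_
  have hx : 0 < x := hx
  have : 0 < x + 1 / 2 := by positivity
  simp only [add_zero]
  field_simp
  ring

lemma completelyMonotonicOn_neg_gammaTrigammaDerivTwo {b : ℝ} (hb : 1 / 2 ≤ b) :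
    CompletelyMonotonicOn (fun x => -gammaTrigammaDerivTwo b x) (Ioi 0) := by
  have hU := uniqueDiffOn_Ioi (0 : ℝ)
  have hb₀ : 0 ≤ b := by linarith
  have hV := (SmoothVanishing.gammaTrigammaDerivTwo hb₀).const_mul (-1)
  simp only [neg_one_mul] at hV
  refine .of_sub_shift hV.1 hV.2 ?_
  -- The case `b = 1/2` plus the correction `(x + 1/2)⁻⁴ - (x + b)⁻⁴`.
  refine ((completelyMonotonicOn_inv_sq_mul_inv_sq_sub.add hU
    (completelyMonotonicOn_inv_pow_four_sub (by norm_num) hb)).const_mul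
      (one_half_pos (α := ℝ)).le).congr fun x hx => ?_
  dsimp only
  rw [neg_sub_neg, ← neg_sub, gammaTrigammaDerivTwo_sub_shift hb₀ hx]
  ring

lemma iteratedDerivWithin_two_gammaTrigammaFun {a x : ℝ} (ha : 0 ≤ a) (hx : 0 < x) :
    iteratedDerivWithin 2 (gammaTrigammaFun a) (Ioi 0) x = gammaTrigammaDerivTwo a x := by
  rw [iteratedDerivWithin_succ_of_hasDerivAt isOpen_Ioi
      (fun y hy => hasDerivAt_gammaTrigammaFun ha hy) 1 hx,
    iteratedDerivWithin_succ_of_hasDerivAt isOpen_Ioi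
      (fun y hy => hasDerivAt_gammaTrigammaDeriv ha hy) 0 hx, iteratedDerivWithin_zero]

/-! ### Sign obstructions: necessity of the conditions -/

lemma exists_gammaTrigammaDerivTwo_neg {a : ℝ} (ha : 0 < a) :
    ∃ x, 0 < x ∧ gammaTrigammaDerivTwo a x < 0 := by
  have hC : 0 ≤ invPowSum 4 a := invPowSum_nonneg 4 ha.le
  have hy : 0 < 4 + invPowSum 4 a := by positivity
  -- With `C = invPowSum 4 a` and `y = 1/x = 4 + C`, the second derivative is at most `y - y²/2 +
  -- C/2`, which is negative.
  refine ⟨(4 + invPowSum 4 a)⁻¹, inv_pos.2 hy, ?_⟩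
  have hx := inv_pos.2 hy
  have h₁ : invPowSum 4 ((4 + invPowSum 4 a)⁻¹ + a) ≤ invPowSum 4 a :=
    invPowSum_anti (by lia) ha (by linarith)
  have h₂ := invPowSum_nonneg 2 (by positivity : 0 ≤ (4 + invPowSum 4 a)⁻¹ + 1)
  rw [gammaTrigammaDerivTwo, invPowSum_eq_add le_rfl hx, inv_pow, inv_pow, inv_inv, inv_inv]
  nlinarith

lemma exists_gammaTrigammaDerivTwo_pos {b : ℝ} (hb : 0 ≤ b) (hb' : b < 1 / 2) :
    ∃ x, 0 < x ∧ 0 < gammaTrigammaDerivTwo b x := by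
  have h2 : 0 < 1 - 2 * b := by linarith
  -- The bound on `x` is exactly the condition `(x + b)² < x (x + 1)`.
  have hpos : ∀ x, 0 < x → b ^ 2 / (1 - 2 * b) < x →
      0 < gammaTrigammaDerivTwo b x - gammaTrigammaDerivTwo b (x + 1) := by
    intro x hx hbx
    rw [div_lt_iff₀ h2] at hbx
    rw [gammaTrigammaDerivTwo_sub_shift hb hx, ← mul_inv]
    have hxb : 0 < x + b := by positivity
    refine mul_pos one_half_pos (sub_pos.2 (inv_strictAnti₀ (by positivity) ?_))
    rw [← mul_pow, show (x + b) ^ 4 = ((x + b) ^ 2) ^ 2 by ring]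
    gcongr
    nlinarith
  have hq : 0 ≤ b ^ 2 / (1 - 2 * b) := by positivity
  set x := b ^ 2 / (1 - 2 * b) + 1 with hxdef
  have hx : 0 < x := by positivity
  have hlim : Tendsto (fun N : ℕ => gammaTrigammaDerivTwo b (x + 1 + N)) atTop (𝓝 0) := by
    simpa using (SmoothVanishing.gammaTrigammaDerivTwo hb).2 0 (x + 1) (by positivity)
  have hnn : 0 ≤ gammaTrigammaDerivTwo b (x + 1) := by
    refine nonneg_of_sub_shift_nonneg (fun N => ?_) hlim
    have hN : (0 : ℝ) ≤ N := N.cast_nonneg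
    exact (hpos (x + 1 + N) (by positivity) (by linarith)).le
  exact ⟨x, hx, by linarith [hpos x hx (by linarith)]⟩

theorem theorem2 :
    (∀ α : ℝ, 0 ≤ α →
      (CompletelyMonotonicOn (fun x => gammaTrigammaFun α x) (Set.Ioi 0) ↔ α = 0)) ∧
    (∀ β : ℝ, 0 ≤ β →
      (CompletelyMonotonicOn (fun x => -gammaTrigammaFun β x) (Set.Ioi 0) ↔ 1 / 2 ≤ β)) := by
  refine ⟨fun α hα => ⟨fun h => ?_, ?_⟩, fun β hβ => ⟨fun h => ?_, fun h => ?_⟩⟩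
  · by_contra hne
    obtain ⟨x, hx, hneg⟩ := exists_gammaTrigammaDerivTwo_neg (lt_of_le_of_ne' hα hne)
    have := h.2 2 x hx
    rw [iteratedDerivWithin_two_gammaTrigammaFun hα hx] at this
    linarith
  · rintro rfl
    exact .of_deriv_deriv (fun x hx => hasDerivAt_gammaTrigammaFun le_rfl hx)
      (fun x hx => hasDerivAt_gammaTrigammaDeriv le_rfl hx)
      completelyMonotonicOn_gammaTrigammaDerivTwo_zero (tendsto_gammaTrigammaFun_nat le_rfl)
  · by_contra! hlt
    obtain ⟨x, hx, hpos⟩ := exists_gammaTrigammaDerivTwo_pos hβ hlt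
    have := h.2 2 x hx
    rw [iteratedDerivWithin_fun_neg, iteratedDerivWithin_two_gammaTrigammaFun hβ hx] at this
    linarith
  · exact .of_deriv_deriv (fun x hx => (hasDerivAt_gammaTrigammaFun hβ hx).neg)
      (fun x hx => (hasDerivAt_gammaTrigammaDeriv hβ hx).neg)
      (completelyMonotonicOn_neg_gammaTrigammaDerivTwo h)
      (by simpa using (tendsto_gammaTrigammaFun_nat hβ).neg)
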